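/- Let $m,s,n$ be positive integers with $n\ge 3$, and let $r\in\mathbb{Z}_n^*$ satisfy $r^{ms}=\pm1$. Let $\overline{\mathrm{CPM}}(m,s,n;r)$ be the simple graph whose vertices are the pairs $\langle i;\mathbf v\rangle$ with $i\in\mathbb{Z}_{ms}$ and $\mathbf v=(v_0,\dots,v_{s-1})\in\mathbb{Z}_n^s$, with adjacencies $\langle i;\mathbf v\rangle\sim\langle i+1;\mathbf v\pm r^i\mathbf e_\ell\rangle$, where $\ell = i \bmod s$, the exponent $i$ is taken in $\{0,\dots,ms-1\}$ and $\mathbf e_\ell$ is the $\ell$-th standard vector. Let $\mathrm{CPM}(m,s,n;r)$ be the connected component of this graph containing $\langle 0;\mathbf 0\rangle$. For integers $t\ge 3$ and $s\ge 1$, the Praeger–Xu graph $\mathrm{PX}(t,s)$ is the simple graph with vertex set $\mathbb{Z}_t\times\mathbb{Z}_2^s$ in which each $(i,(v_0,\dots,v_{s-1}))$ is adjacent to $(i+1,(v_1,\dots,v_{s-1},0))$ and $(i+1,(v_1,\dots,v_{s-1},1))$. A $2$-arc of a graph is a sequence of vertices $(w_0,w_1,w_2)$ with $w_0\sim w_1\sim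 w_2$ and $w_0\ne w_2$; the graph is $2$-arc-transitive if its automorphism group is transitive on its $2$-arcs. **Proposition.** Let $m,s$ be positive integers with $m$ even and $s\ge 2$. Then the graph $\Gamma=\mathrm{CPM}(m,s,4;1)$ is isomorphic to the Praeger–Xu graph $\mathrm{PX}(ms,s)$. If $m=s=2$, then $\Gamma$ is isomorphic to the $4$-cube, it is $2$-arc-transitive, and all vertex-stabilizers in $\mathrm{Aut}(\Gamma)$ have order $24$. Otherwise $\Gamma$ is not $2$-arc-transitive, and all vertex-stabilizers in $\mathrm{Aut}(\Gamma)$ have order $2^{s(m-1)+1}$. -/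

import Mathlib

/-- The adjacency rule `⟨i; v⟩ → ⟨i + 1; v ± r ^ i e_ℓ⟩`, `ℓ = i mod s`, on pairs `⟨i; v⟩` with
`i ∈ ℤ_{ms}` and `v ∈ ℤ_n ^ s`. Here `i` in `r ^ i` and in `i mod s` stands for its representative
in `{0, …, ms - 1}` (for `m, s ≥ 1`). -/
def cpmArc (m s n : ℕ) (r : (ZMod n)ˣ) (a b : ZMod (m * s) × (Fin s → ZMod n)) : Prop :=
  b.1 = a.1 + 1 ∧
    ((b.2 = fun j => a.2 j + if (j : ℕ) = a.1.val % s then (r : ZMod n) ^ a.1.val else 0) ∨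
      (b.2 = fun j => a.2 j - if (j : ℕ) = a.1.val % s then (r : ZMod n) ^ a.1.val else 0))

/-- The whole (possibly disconnected) CPM graph. -/
def cpmBar (m s n : ℕ) (r : (ZMod n)ˣ) : SimpleGraph (ZMod (m * s) × (Fin s → ZMod n)) :=
  SimpleGraph.fromRel (cpmArc m s n r)

/-- The vertex set of the connected component of `⟨0; 0⟩` in the whole CPM graph. -/
abbrev CPMVertex (m s n : ℕ) (r : (ZMod n)ˣ) : Type :=
  (cpmBar m s n r).connectedComponentMk (0, 0)

/-- The graph `CPM(m, s, n; r)`: the connected component of `⟨0; 0⟩` in the whole CPM graph. -/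
def CPM (m s n : ℕ) (r : (ZMod n)ˣ) : SimpleGraph (CPMVertex m s n r) :=
  ((cpmBar m s n r).connectedComponentMk (0, 0)).toSimpleGraph

/-- The Praeger–Xu graph `PX(t, s)` (for `t ≥ 3`, `s ≥ 1`): `(i, (v_0, …, v_{s-1}))` is adjacent to
`(i + 1, (v_1, …, v_{s-1}, x))` for each `x ∈ ℤ_2`. -/
def praegerXu (t s : ℕ) : SimpleGraph (ZMod t × (Fin s → ZMod 2)) :=
  SimpleGraph.fromRel fun a b =>
    b.1 = a.1 + 1 ∧
      ∃ x : ZMod 2, b.2 = fun j : Fin s => if h : (j : ℕ) + 1 < s then a.2 ⟨(j : ℕ) + 1, h⟩ else x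

/-- The `d`-cube: binary words of length `d`, adjacent when they differ in exactly one place. -/
def cubeGraph (d : ℕ) : SimpleGraph (Fin d → ZMod 2) where
  Adj v w := hammingDist v w = 1
  symm := ⟨fun v w h => by rw [hammingDist_comm]; exact h⟩
  loopless := ⟨fun v h => by simp at h⟩

/-- A `k`-arc of `G`: a sequence of vertices `w_0, …, w_k` with consecutive ones adjacent and
`w_i ≠ w_{i+2}`. -/
def IsKArc {V : Type*} (G : SimpleGraph V) (k : ℕ) (w : Fin (k + 1) → V) : Prop :=
  (∀ i : Fin k, G.Adj (w i.castSucc) (w i.succ)) ∧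
    ∀ i j : Fin (k + 1), (j : ℕ) = (i : ℕ) + 2 → w i ≠ w j

/-- `G` is `k`-arc-transitive: its automorphism group is transitive on its `k`-arcs. -/
def IsKArcTransitive {V : Type*} (G : SimpleGraph V) (k : ℕ) : Prop :=
  ∀ w w' : Fin (k + 1) → V, IsKArc G k w → IsKArc G k w' →
    ∃ φ : G ≃g G, ∀ i, φ (w i) = w' i

/-!
The component of `⟨0; 0⟩` in the CPM graph for `n = 4`, `r = 1` is found by splitting `ZMod 4` into
a low and a high bit. Each step changes the parity of one coordinate, so that the parities are
determined by the layer; this is consistent around the cycle of layers because `m` is even. The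
step by `± 1` also sets the high bit of that coordinate arbitrarily and leaves the other
coordinates alone. Reading the high bits cyclically from the coordinate that changes next turns this
into the shift of the Praeger–Xu graph (`nonempty_CPM_iso_praegerXu`), and the rest is about
`PX(t, s)` with `t = m * s`.

A vertex `(i, v)` of `PX(t, s)` is a binary word on the positions `i, …, i + s - 1` of `ZMod t`. If
`t ≥ 5` and `s ≥ 2`, two edges at a vertex lie in a common `4`-cycle if and only if both lead out of
the vertex or both lead into it (`praegerXu_exists_ne_iff`). This shows that the graph is not
`2`-arc-transitive, and that an automorphism preserves all arcs or reverses all of them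
(`praegerXu_preserves_arcs`). If it preserves arcs and layers, then by shifting words forwards and
backwards every letter of the image is seen to depend only on the same letter of the given word,
so that the automorphism adds a fixed bit in each position of `ZMod t` (`praegerXu_eq_pxFlip`). Hence
the stabilizer of `(0, 0)` consists of the `2 ^ (t - s)` flips that are trivial on the positions
`0, …, s - 1`, and of their products with a reflection.

In the case `t = 4`, `s = 2` the graph is the `4`-cube, whose automorphisms fixing `0` are the
permutations of the coordinates (`cubeGraph_eq_of_fix`).
-/

/-! ### Properties preserved along edges -/

theorem SimpleGraph.Reachable.of_forall_adj {V : Type*} {G : SimpleGraph V} {P : V → Prop}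
    (h : ∀ a b, G.Adj a b → P a → P b) {a b : V} (hab : G.Reachable a b) (ha : P a) : P b := by
  obtain ⟨p⟩ := hab
  induction p with
  | nil => exact ha
  | cons hadj _ ih => exact ih (h _ _ hadj ha)

/-! ### The arcs of the Praeger–Xu graph -/

/-- The orientation of `praegerXu t s`: an arc goes from each vertex `(i, v)` to the two vertices
`(i + 1, w)` whose word `w` is `v` without its first letter, followed by any letter. -/
def pxArc {t s : ℕ} (a b : ZMod t × (Fin s → ZMod 2)) : Prop :=
  b.1 = a.1 + 1 ∧ ∀ (k : ℕ) (h : k + 1 < s), b.2 ⟨k, by omega⟩ = a.2 ⟨k + 1, h⟩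

/-- The word `v` without its first letter, followed by `x`. -/
def pxNext {s : ℕ} (v : Fin s → ZMod 2) (x : ZMod 2) : Fin s → ZMod 2 :=
  fun j => if h : (j : ℕ) + 1 < s then v ⟨(j : ℕ) + 1, h⟩ else x

/-- The word `v` without its last letter, preceded by `x`. -/
def pxPrev {s : ℕ} (v : Fin s → ZMod 2) (x : ZMod 2) : Fin s → ZMod 2 :=
  fun j => if (j : ℕ) = 0 then x else v ⟨(j : ℕ) - 1, by omega⟩

theorem pxArc_next {t s : ℕ} (i : ZMod t) (v : Fin s → ZMod 2) (x : ZMod 2) :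
    pxArc (i, v) (i + 1, pxNext v x) :=
  ⟨rfl, fun k h => by simp [pxNext, h]⟩

theorem pxArc_prev {t s : ℕ} (i : ZMod t) (v : Fin s → ZMod 2) (x : ZMod 2) :
    pxArc (i - 1, pxPrev v x) (i, v) :=
  ⟨by simp, fun k h => by simp [pxPrev]⟩

theorem praegerXu_adj_iff {t s : ℕ} (ht : 2 ≤ t) (hs : 1 ≤ s) (a b : ZMod t × (Fin s → ZMod 2)) :
    (praegerXu t s).Adj a b ↔ pxArc a b ∨ pxArc b a := by
  have : Fact (1 < t) := ⟨ht⟩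
  have key : ∀ a b : ZMod t × (Fin s → ZMod 2), (b.1 = a.1 + 1 ∧ ∃ x : ZMod 2,
      b.2 = fun j : Fin s => if h : (j : ℕ) + 1 < s then a.2 ⟨(j : ℕ) + 1, h⟩ else x) ↔
      pxArc a b := by
    intro a b
    refine and_congr_right fun _ => ⟨?_, fun h => ⟨b.2 ⟨s - 1, by omega⟩, ?_⟩⟩
    · rintro ⟨x, hx⟩ k hk
      simp [hx, hk]
    · funext j
      split_ifs with hj
      · exact h j hj
      · exact congrArg b.2 (Fin.ext (show (j : ℕ) = s - 1 by omega))
  have hne : ∀ a b : ZMod t × (Fin s → ZMod 2), pxArc a b → a ≠ b := by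
    rintro a b ⟨h, -⟩ rfl
    simp at h
  rw [praegerXu, SimpleGraph.fromRel_adj, key, key]
  refine ⟨fun h => h.2, fun h => ⟨?_, h⟩⟩
  rcases h with h | h
  · exact hne _ _ h
  · exact (hne _ _ h).symm

/-- Two words in the same layer are joined by a walk that shifts until the words agree and then
shifts back. -/
theorem praegerXu_reachable_of_agree {t s : ℕ} (ht : 2 ≤ t) (hs : 1 ≤ s) (k : ℕ) :
    ∀ (i : ZMod t) (v w : Fin s → ZMod 2), (∀ j : Fin s, k ≤ j → v j = w j) →
      (praegerXu t s).Reachable (i, v) (i, w) := by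
  induction k with
  | zero =>
    intro i v w h
    rw [funext fun j => h j (Nat.zero_le _)]
  | succ k ih =>
    intro i v w h
    have step : ∀ u : Fin s → ZMod 2, (praegerXu t s).Reachable (i, u) (i + 1, pxNext u 0) :=
      fun u => ((praegerXu_adj_iff ht hs _ _).2 (Or.inl (pxArc_next i u 0))).reachable
    refine (step v).trans (.trans (ih _ _ _ fun j hj => ?_) (step w).symm)
    unfold pxNext
    split_ifs with h'
    · exact h _ (by simpa using hj)
    · rfl

theorem praegerXu_connected {t s : ℕ} (ht : 2 ≤ t) (hs : 1 ≤ s) :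
    (praegerXu t s).Connected := by
  have : NeZero t := ⟨by omega⟩
  have same : ∀ (i : ZMod t) (v w : Fin s → ZMod 2), (praegerXu t s).Reachable (i, v) (i, w) :=
    fun i v w => praegerXu_reachable_of_agree ht hs s i v w fun j hj => by omega
  have layer : ∀ n : ℕ, (praegerXu t s).Reachable (0, 0) ((n : ZMod t), 0) := by
    intro n
    induction n with
    | zero => simp
    | succ n ih =>
      have h := ((praegerXu_adj_iff ht hs _ _).2 (Or.inl (pxArc_next (n : ZMod t) 0 0))).reachable
      rw [Nat.cast_succ]
      exact (ih.trans h).trans (same _ _ _)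
  have base : ∀ a, (praegerXu t s).Reachable (0, 0) a := by
    rintro ⟨i, v⟩
    have h := layer i.val
    rw [ZMod.natCast_zmod_val] at h
    exact h.trans (same _ _ _)
  exact ⟨fun a b => (base a).symm.trans (base b)⟩

/-! ### Automorphisms of the Praeger–Xu graph -/

theorem praegerXu_not_arc_symm {t s : ℕ} (ht : 3 ≤ t) {a b : ZMod t × (Fin s → ZMod 2)}
    (h : pxArc a b) : ¬ pxArc b a := by
  rintro ⟨h', -⟩
  rw [h.1, add_assoc, left_eq_add] at h'
  have h2 : ((2 : ℕ) : ZMod t) = 0 := by rw [← h']; norm_num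
  rw [ZMod.natCast_eq_zero_iff] at h2
  exact absurd (Nat.le_of_dvd two_pos h2) (by omega)

theorem praegerXu_adj_cases {t s : ℕ} (ht : 3 ≤ t) (hs : 1 ≤ s) {a b : ZMod t × (Fin s → ZMod 2)}
    (h : (praegerXu t s).Adj a b) : pxArc a b ↔ ¬ pxArc b a :=
  ⟨praegerXu_not_arc_symm ht,
    fun h' => ((praegerXu_adj_iff (by omega) hs _ _).1 h).resolve_right h'⟩

/-- The automorphism given by a bijection that preserves the relation of being joined by an arc in
one of the two directions. -/
def praegerXuIso {t s : ℕ} (ht : 2 ≤ t) (hs : 1 ≤ s)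
    (e : (ZMod t × (Fin s → ZMod 2)) ≃ (ZMod t × (Fin s → ZMod 2)))
    (h : ∀ a b, (pxArc (e a) (e b) ∨ pxArc (e b) (e a)) ↔ (pxArc a b ∨ pxArc b a)) :
    praegerXu t s ≃g praegerXu t s where
  toEquiv := e
  map_rel_iff' := by
    intro a b
    rw [praegerXu_adj_iff ht hs, praegerXu_adj_iff ht hs]
    exact h a b

/-- The automorphism that moves each vertex `c` layers on. -/
def pxRotate {t s : ℕ} (ht : 2 ≤ t) (hs : 1 ≤ s) (c : ZMod t) :
    praegerXu t s ≃g praegerXu t s :=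
  praegerXuIso ht hs ((Equiv.addRight c).prodCongr (Equiv.refl _)) <| by
    have : ∀ a b : ZMod t × (Fin s → ZMod 2), pxArc ((Equiv.addRight c).prodCongr (Equiv.refl _) a)
        ((Equiv.addRight c).prodCongr (Equiv.refl _) b) ↔ pxArc a b := by
      intro a b
      simp [pxArc, add_right_comm a.1 c 1]
    intro a b
    rw [this, this]

/-- The involution adding `h (i + k)` to the `k`-th letter of the word at each vertex `(i, v)`. -/
def pxFlipEquiv {t s : ℕ} (h : ZMod t → ZMod 2) :
    (ZMod t × (Fin s → ZMod 2)) ≃ (ZMod t × (Fin s → ZMod 2)) :=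
  Function.Involutive.toPerm (fun a => (a.1, fun k => a.2 k + h (a.1 + (k : ℕ)))) <| by
    rintro ⟨i, v⟩
    ext k
    · rfl
    · simp [add_assoc, CharTwo.add_self_eq_zero]

theorem pxArc_flip {t s : ℕ} (h : ZMod t → ZMod 2) (a b : ZMod t × (Fin s → ZMod 2)) :
    pxArc (pxFlipEquiv h a) (pxFlipEquiv h b) ↔ pxArc a b := by
  refine and_congr_right fun hab => forall₂_congr fun k hk => ?_
  change b.1 = a.1 + 1 at hab
  change b.2 _ + h (b.1 + (k : ℕ)) = a.2 _ + h (a.1 + ((k + 1 : ℕ) : ZMod t)) ↔ _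
  rw [hab, Nat.cast_succ, add_assoc, add_comm 1 (k : ZMod t)]
  exact add_left_inj _

/-- The automorphism of `praegerXu t s` that reads a vertex `(i, v)` as a word written on the
positions `i, …, i + s - 1` of `ZMod t` and adds `h j` to the letter in position `j`. -/
def pxFlip {t s : ℕ} (ht : 2 ≤ t) (hs : 1 ≤ s) (h : ZMod t → ZMod 2) :
    praegerXu t s ≃g praegerXu t s :=
  praegerXuIso ht hs (pxFlipEquiv h) fun a b => by rw [pxArc_flip, pxArc_flip]

theorem pxFlip_apply {t s : ℕ} (ht : 2 ≤ t) (hs : 1 ≤ s) (h : ZMod t → ZMod 2)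
    (a : ZMod t × (Fin s → ZMod 2)) :
    pxFlip ht hs h a = (a.1, fun k => a.2 k + h (a.1 + (k : ℕ))) := rfl

theorem pxArc_reverse {t s : ℕ} {a b : ZMod t × (Fin s → ZMod 2)} (h : pxArc a b) :
    pxArc (-b.1, fun k => b.2 k.rev) (-a.1, fun k => a.2 k.rev) := by
  refine ⟨by simp [h.1], fun k hk => ?_⟩
  have h' := h.2 (s - (k + 1 + 1)) (by omega)
  refine Eq.trans (congrArg a.2 (Fin.ext ?_)) (h'.symm.trans (congrArg b.2 (Fin.ext ?_)))
  · change s - (k + 1) = s - (k + 1 + 1) + 1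
    omega
  · rfl

/-- The reflection fixing `(0, 0)`: it reverses words, and all arcs. -/
def pxReverse {t s : ℕ} (ht : 2 ≤ t) (hs : 1 ≤ s) : praegerXu t s ≃g praegerXu t s :=
  praegerXuIso ht hs (Function.Involutive.toPerm (fun a => (-a.1, fun k => a.2 k.rev))
    fun a => by simp) <| by
    have key : ∀ a b : ZMod t × (Fin s → ZMod 2),
        pxArc (-a.1, fun k => a.2 k.rev) (-b.1, fun k => b.2 k.rev) ↔ pxArc b a :=
      fun a b => ⟨fun h => by simpa using pxArc_reverse h, pxArc_reverse⟩
    exact fun a b => (or_congr (key a b) (key b a)).trans or_comm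

theorem pxReverse_apply {t s : ℕ} (ht : 2 ≤ t) (hs : 1 ≤ s) (a : ZMod t × (Fin s → ZMod 2)) :
    pxReverse ht hs a = (-a.1, fun k => a.2 k.rev) := rfl

theorem praegerXu_exists_map_zero {t s : ℕ} (ht : 2 ≤ t) (hs : 1 ≤ s) (hst : s ≤ t)
    (a : ZMod t × (Fin s → ZMod 2)) : ∃ φ : praegerXu t s ≃g praegerXu t s, φ (0, 0) = a := by
  obtain ⟨i, v⟩ := a
  refine ⟨(pxRotate ht hs i).trans (pxFlip ht hs
    fun j => if h : (j - i).val < s then v ⟨_, h⟩ else 0), ?_⟩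
  have hrot : pxRotate ht hs i (0, (0 : Fin s → ZMod 2)) = (0 + i, 0) := rfl
  rw [RelIso.trans_apply, hrot, pxFlip_apply]
  ext k
  · simp
  · have : ((k : ℕ) : ZMod t).val = k := ZMod.val_natCast_of_lt (by omega)
    simp [this]

/-- The two out-neighbours of a vertex have two common in-neighbours. -/
theorem pxArc_exists_ne_of_out {t s : ℕ} (hs : 1 ≤ s) {v a b : ZMod t × (Fin s → ZMod 2)}
    (ha : pxArc v a) (hb : pxArc v b) : ∃ x ≠ v, pxArc x a ∧ pxArc x b := by
  refine ⟨(v.1, Function.update v.2 ⟨0, hs⟩ (v.2 ⟨0, hs⟩ + 1)), fun h => ?_,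
    ⟨ha.1, fun k hk => ?_⟩, ⟨hb.1, fun k hk => ?_⟩⟩
  · have := congrFun (congrArg Prod.snd h) ⟨0, hs⟩
    simp at this
  · rw [ha.2 k hk]
    simp [Function.update, Fin.ext_iff]
  · rw [hb.2 k hk]
    simp [Function.update, Fin.ext_iff]

theorem pxArc_exists_ne_of_in {t s : ℕ} (hs : 1 ≤ s) {v a b : ZMod t × (Fin s → ZMod 2)}
    (ha : pxArc a v) (hb : pxArc b v) : ∃ x ≠ v, pxArc a x ∧ pxArc b x := by
  have hs' : s - 1 < s := by omega
  refine ⟨(v.1, Function.update v.2 ⟨s - 1, hs'⟩ (v.2 ⟨s - 1, hs'⟩ + 1)), fun h => ?_,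
    ⟨ha.1, fun k hk => ?_⟩, ⟨hb.1, fun k hk => ?_⟩⟩
  · have := congrFun (congrArg Prod.snd h) ⟨s - 1, hs'⟩
    simp at this
  · rw [← ha.2 k hk]
    exact Function.update_of_ne (fun h => by have := congrArg Fin.val h; simp at this; omega) _ _
  · rw [← hb.2 k hk]
    exact Function.update_of_ne (fun h => by have := congrArg Fin.val h; simp at this; omega) _ _

/-- A directed path of length two is the only walk of length two between its ends: in particular
it lies in no `4`-cycle. For `t = 4` going on around the layers would give further ones. -/
theorem pxArc_eq_of_adj {t s : ℕ} (ht : 5 ≤ t) (hs : 2 ≤ s)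
    {a v b x : ZMod t × (Fin s → ZMod 2)} (ha : pxArc a v) (hb : pxArc v b)
    (hxa : (praegerXu t s).Adj x a) (hxb : (praegerXu t s).Adj x b) : x = v := by
  have small : ∀ n : ℕ, 0 < n → n < 5 → ((n : ℕ) : ZMod t) ≠ 0 := by
    intro n h0 h5 h
    rw [ZMod.natCast_eq_zero_iff] at h
    exact absurd (Nat.le_of_dvd h0 h) (by omega)
  have h2 := small 2 (by omega) (by omega)
  have h4 := small 4 (by omega) (by omega)
  push_cast at h2 h4
  rw [praegerXu_adj_iff (by omega) (by omega)] at hxa hxb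
  have hb1 : b.1 = a.1 + 1 + 1 := by rw [hb.1, ha.1]
  rcases hxa with hxa | hxa
  · exfalso
    have h := hxa.1
    rcases hxb with hxb | hxb
    · have := hxb.1
      rw [hb1, h] at this
      exact h2 (by linear_combination this)
    · have := hxb.1
      rw [hb1, h] at this
      exact h4 (by linear_combination -this)
  · rcases hxb with hxb | hxb
    · refine Prod.ext (hxa.1.trans ha.1.symm) (funext fun j => ?_)
      by_cases hj : (j : ℕ) + 1 < s
      · exact (hxa.2 j hj).trans (ha.2 j hj).symm
      · -- The last letter is read off from the next vertex `b`.
        have hj' : (⟨s - 2 + 1, by omega⟩ : Fin s) = j := Fin.ext (by simp; omega)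
        have := (hxb.2 (s - 2) (by omega)).symm.trans (hb.2 (s - 2) (by omega))
        rwa [hj'] at this
    · exfalso
      have := hxb.1
      rw [hxa.1, hb1] at this
      exact h2 (by linear_combination -this)

/-- Whether two edges at `v` have the same direction can be told from the graph alone: it means
that they lie together in a `4`-cycle. -/
theorem praegerXu_exists_ne_iff {t s : ℕ} (ht : 5 ≤ t) (hs : 2 ≤ s)
    {v a b : ZMod t × (Fin s → ZMod 2)}
    (ha : (praegerXu t s).Adj v a) (hb : (praegerXu t s).Adj v b) :
    (∃ x ≠ v, (praegerXu t s).Adj x a ∧ (praegerXu t s).Adj x b) ↔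
      (pxArc v a ↔ pxArc v b) := by
  have adj := praegerXu_adj_iff (t := t) (s := s) (by omega) (by omega)
  constructor
  · rintro ⟨x, hx, hxa, hxb⟩
    by_contra hne
    rcases (adj _ _).1 ha with ha' | ha' <;> rcases (adj _ _).1 hb with hb' | hb'
    · exact hne (iff_of_true ha' hb')
    · exact hx (pxArc_eq_of_adj ht hs hb' ha' hxb hxa)
    · exact hx (pxArc_eq_of_adj ht hs ha' hb' hxa hxb)
    · exact hne (iff_of_false (praegerXu_not_arc_symm (by omega) ha')
        (praegerXu_not_arc_symm (by omega) hb'))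
  · intro h
    rcases (adj _ _).1 ha with ha' | ha'
    · obtain ⟨x, hx, h1, h2⟩ := pxArc_exists_ne_of_out (by omega) ha' (h.1 ha')
      exact ⟨x, hx, (adj _ _).2 (.inl h1), (adj _ _).2 (.inl h2)⟩
    · have hb' := ((adj _ _).1 hb).resolve_left
        fun hb' => praegerXu_not_arc_symm (by omega) ha' (h.2 hb')
      obtain ⟨x, hx, h1, h2⟩ := pxArc_exists_ne_of_in (by omega) ha' hb'
      exact ⟨x, hx, (adj _ _).2 (.inr h1), (adj _ _).2 (.inr h2)⟩

theorem praegerXu_same_direction_iff {t s : ℕ} (ht : 5 ≤ t) (hs : 2 ≤ s)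
    (φ : praegerXu t s ≃g praegerXu t s) {v a b : ZMod t × (Fin s → ZMod 2)}
    (ha : (praegerXu t s).Adj v a) (hb : (praegerXu t s).Adj v b) :
    (pxArc (φ v) (φ a) ↔ pxArc (φ v) (φ b)) ↔ (pxArc v a ↔ pxArc v b) := by
  rw [← praegerXu_exists_ne_iff ht hs ha hb,
    ← praegerXu_exists_ne_iff ht hs (φ.map_adj_iff.2 ha) (φ.map_adj_iff.2 hb),
    φ.surjective.exists]
  simp [φ.map_adj_iff]

/-- An automorphism that preserves the direction of one arc preserves all directions. -/
theorem praegerXu_preserves_arcs {t s : ℕ} (ht : 5 ≤ t) (hs : 2 ≤ s)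
    (φ : praegerXu t s ≃g praegerXu t s) {a₀ b₀ : ZMod t × (Fin s → ZMod 2)}
    (h₀ : pxArc a₀ b₀) (hφ : pxArc (φ a₀) (φ b₀)) {a b : ZMod t × (Fin s → ZMod 2)}
    (hab : pxArc a b) : pxArc (φ a) (φ b) := by
  have adj := praegerXu_adj_iff (t := t) (s := s) (by omega) (by omega)
  have hcon := praegerXu_connected (t := t) (s := s) (by omega) (by omega)
  refine ((hcon.preconnected a₀ a).of_forall_adj (P := fun v => ∀ x, (praegerXu t s).Adj v x →
    (pxArc (φ v) (φ x) ↔ pxArc v x)) ?_ ?_ _ ((adj _ _).2 (.inl hab))).2 hab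
  · intro v w hvw hv x hwx
    have h1 := praegerXu_same_direction_iff ht hs φ hvw.symm hwx
    have h2 := hv w hvw
    have h3 := praegerXu_adj_cases (by omega) (by omega) hvw
    have h4 := praegerXu_adj_cases (by omega) (by omega) (φ.map_adj_iff.2 hvw)
    tauto
  · intro x hx
    have h1 := praegerXu_same_direction_iff ht hs φ ((adj _ _).2 (.inl h₀)) hx
    tauto

/-- If two words agree from the `k`-th letter on, then so do their images: shift them by `k` places,
so that they become equal. -/
theorem pxArc_map_agree_suffix {t s : ℕ}
    {φ : ZMod t × (Fin s → ZMod 2) → ZMod t × (Fin s → ZMod 2)}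
    (hφ : ∀ a b, pxArc a b → pxArc (φ a) (φ b)) (k : ℕ) :
    ∀ (i : ZMod t) (v w : Fin s → ZMod 2), (∀ j : Fin s, k ≤ j → v j = w j) →
      ∀ j : Fin s, k ≤ j → (φ (i, v)).2 j = (φ (i, w)).2 j := by
  induction k with
  | zero =>
    intro i v w h j _
    rw [funext fun j => h j (Nat.zero_le _)]
  | succ k ih =>
    rintro i v w h ⟨j, hj⟩ hkj
    obtain ⟨j, rfl⟩ : ∃ l, j = l + 1 := ⟨j - 1, by simp at hkj; omega⟩
    have hkj' : k ≤ j := by simpa using hkj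
    rw [← (hφ _ _ (pxArc_next i v 0)).2 j hj, ← (hφ _ _ (pxArc_next i w 0)).2 j hj]
    refine ih _ _ _ (fun l hl => ?_) ⟨j, _⟩ hkj'
    unfold pxNext
    split_ifs
    · exact h _ (by simpa using hl)
    · rfl

theorem pxArc_map_agree_prefix {t s : ℕ}
    {φ : ZMod t × (Fin s → ZMod 2) → ZMod t × (Fin s → ZMod 2)}
    (hφ : ∀ a b, pxArc a b → pxArc (φ a) (φ b)) (k : ℕ) :
    ∀ (i : ZMod t) (v w : Fin s → ZMod 2), (∀ j : Fin s, j + k < s → v j = w j) →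
      ∀ j : Fin s, j + k < s → (φ (i, v)).2 j = (φ (i, w)).2 j := by
  induction k with
  | zero =>
    intro i v w h j _
    rw [funext fun j => h j (by simp)]
  | succ k ih =>
    rintro i v w h ⟨j, hj⟩ hkj
    simp only at hkj
    have hj' : j + 1 < s := by omega
    rw [(hφ _ _ (pxArc_prev i v 0)).2 j hj', (hφ _ _ (pxArc_prev i w 0)).2 j hj']
    refine ih _ _ _ (fun l hl => ?_) ⟨j + 1, _⟩ (by simp only; omega)
    unfold pxPrev
    split_ifs with hl0
    · rfl
    · exact h _ (by simp only; omega)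

/-- A letter of the image of `(i, v)` depends only on the layer and on the same letter of `v`. -/
theorem pxArc_map_agree {t s : ℕ} {φ : ZMod t × (Fin s → ZMod 2) → ZMod t × (Fin s → ZMod 2)}
    (hφ : ∀ a b, pxArc a b → pxArc (φ a) (φ b)) (i : ZMod t) {v w : Fin s → ZMod 2} {k : Fin s}
    (h : v k = w k) : (φ (i, v)).2 k = (φ (i, w)).2 k := by
  -- Pass through the word that agrees with `w` up to `k` and with `v` from `k` on.
  refine (pxArc_map_agree_suffix hφ k i v (fun l => if l < k then w l else v l) (fun l hl => ?_)
    k le_rfl).trans (pxArc_map_agree_prefix hφ (s - 1 - k) i _ w (fun l hl => ?_) k (by omega))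
  · rw [if_neg (by simpa using hl)]
  · split_ifs with hlk
    · rfl
    · have : l = k := Fin.ext (by rw [Fin.lt_def] at hlk; omega)
      rw [this, h]

/-- The flips are the only automorphisms that preserve arcs and layers. -/
theorem praegerXu_eq_pxFlip {t s : ℕ} (ht : 2 ≤ t) (hs : 1 ≤ s)
    (φ : praegerXu t s ≃g praegerXu t s) (hφ : ∀ a b, pxArc a b → pxArc (φ a) (φ b))
    (h0 : (φ (0, 0)).1 = 0) :
    φ = pxFlip ht hs fun j => (φ (j, 0)).2 ⟨0, hs⟩ := by
  have layer : ∀ a, (φ a).1 = a.1 := by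
    refine fun a => ((praegerXu_connected ht hs).preconnected (0, 0) a).of_forall_adj
      (P := fun a => (φ a).1 = a.1) (fun a b hab ha => ?_) h0
    rcases (praegerXu_adj_iff ht hs _ _).1 hab with h | h
    · rw [(hφ _ _ h).1, h.1, ha]
    · have := (hφ _ _ h).1
      rw [ha, h.1] at this
      exact (add_right_cancel this).symm
  have value : ∀ i v k, (φ (i, v)).2 k = v k + (φ (i, 0)).2 k := by
    intro i v k
    have hbit : v k = 0 ∨ v k = 1 := by
      generalize v k = x
      revert x
      decide
    rcases hbit with hv | hv
    · rw [hv, zero_add]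
      exact pxArc_map_agree hφ i hv
    · rw [pxArc_map_agree hφ i (w := Pi.single k 1) (by simp [hv]), hv]
      have hne : (φ (i, Pi.single k 1)).2 k ≠ (φ (i, 0)).2 k := by
        intro h
        have heq : φ (i, Pi.single k 1) = φ (i, 0) := by
          refine Prod.ext (by rw [layer, layer]) (funext fun l => ?_)
          by_cases hl : l = k
          · rw [hl, h]
          · exact pxArc_map_agree hφ i (by simp [hl])
        have := congrFun (congrArg Prod.snd (φ.injective heq)) k
        simp at this
      revert hne
      generalize (φ (i, Pi.single k 1)).2 k = x
      generalize (φ (i, 0)).2 k = y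
      revert x y
      decide
  have shift : ∀ (k : ℕ) (hk : k < s) (i : ZMod t),
      (φ (i, 0)).2 ⟨k, hk⟩ = (φ (i + (k : ℕ), 0)).2 ⟨0, hs⟩ := by
    intro k
    induction k with
    | zero => simp
    | succ k ih =>
      intro hk i
      have hnext : pxNext (0 : Fin s → ZMod 2) 0 = 0 := by
        funext j
        simp [pxNext]
      have := (hφ _ _ (pxArc_next i 0 0)).2 k hk
      rw [← this, hnext, ih, Nat.cast_succ, add_assoc, add_comm 1 (k : ZMod t)]
  refine RelIso.ext fun a => ?_
  rw [pxFlip_apply]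
  refine Prod.ext (layer a) (funext fun k => ?_)
  exact (value a.1 a.2 k).trans (congrArg _ (shift k k.2 a.1))

/-! ### Vertex-stabilizers and 2-arcs of the Praeger–Xu graph -/

/-- There are `2 ^ (t - s)` binary words on the positions in `ZMod t` that vanish on a window of
`s` positions. -/
theorem card_words_vanishing_on_window {t s : ℕ} [NeZero t] (hst : s ≤ t) :
    Nat.card {h : ZMod t → ZMod 2 // ∀ k : Fin s, h ((k : ℕ) : ZMod t) = 0} = 2 ^ (t - s) := by
  classical
  have hinj : Function.Injective fun k : Fin s => ((k : ℕ) : ZMod t) := by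
    intro k l h
    have := congrArg ZMod.val h
    simp only at this
    rw [ZMod.val_natCast_of_lt (by omega), ZMod.val_natCast_of_lt (by omega)] at this
    exact Fin.ext this
  let W : Finset (ZMod t) := Finset.univ.image fun k : Fin s => ((k : ℕ) : ZMod t)
  have hW : W.card = s := by
    rw [Finset.card_image_of_injective _ hinj, Finset.card_univ, Fintype.card_fin]
  let e : {h : ZMod t → ZMod 2 // ∀ k : Fin s, h ((k : ℕ) : ZMod t) = 0} ≃
      ({j // j ∉ W} → ZMod 2) :=
    { toFun := fun h j => h.1 j
      invFun := fun g => ⟨fun j => if hj : j ∉ W then g ⟨j, hj⟩ else 0,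
        fun k => dif_neg (by simp [W])⟩
      left_inv := by
        rintro ⟨h, hh⟩
        refine Subtype.ext (funext fun j => ?_)
        by_cases hj : j ∈ W
        · obtain ⟨k, -, rfl⟩ := Finset.mem_image.1 hj
          simp [hj, hh]
        · simp [hj]
      right_inv := by
        intro g
        funext j
        simp [j.2] }
  rw [Nat.card_congr e, Nat.card_fun, Nat.card_zmod, Nat.card_eq_fintype_card,
    Fintype.card_subtype_compl, ZMod.card, Fintype.card_coe, hW]

/-- The stabilizer of `(0, 0)` consists of the flips vanishing on the window of `(0, 0)`, and of
their products with the reflection. -/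
theorem praegerXu_card_stabilizer_zero {t s : ℕ} (ht : 5 ≤ t) (hs : 2 ≤ s) (hst : s ≤ t) :
    Nat.card (MulAction.stabilizer (praegerXu t s ≃g praegerXu t s)
      ((0, 0) : ZMod t × (Fin s → ZMod 2))) = 2 ^ (t - s + 1) := by
  have : NeZero t := ⟨by omega⟩
  have ht2 : 2 ≤ t := by omega
  have hs1 : 1 ≤ s := by omega
  have hflip : ∀ h : {h : ZMod t → ZMod 2 // ∀ k : Fin s, h ((k : ℕ) : ZMod t) = 0},
      pxFlip ht2 hs1 h.1 (0, 0) = (0, 0) := by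
    intro h
    rw [pxFlip_apply]
    ext k
    · rfl
    · simp [h.2]
  have hrev : pxReverse ht2 hs1 (0, 0) = ((0, 0) : ZMod t × (Fin s → ZMod 2)) := by
    rw [pxReverse_apply]
    simp only [neg_zero]
    rfl
  let a₁ : ZMod t × (Fin s → ZMod 2) := (0 + 1, pxNext 0 0)
  have harc : pxArc (0, 0) a₁ := pxArc_next 0 0 0
  have hrevarc : pxArc (pxReverse ht2 hs1 a₁) (0, 0) := by
    have h := pxArc_reverse harc
    rwa [← pxReverse_apply ht2 hs1, ← pxReverse_apply ht2 hs1 (0, 0), hrev] at h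
  let F : Bool × {h : ZMod t → ZMod 2 // ∀ k : Fin s, h ((k : ℕ) : ZMod t) = 0} →
      MulAction.stabilizer (praegerXu t s ≃g praegerXu t s)
        ((0, 0) : ZMod t × (Fin s → ZMod 2)) := fun p =>
    ⟨if p.1 then pxReverse ht2 hs1 * pxFlip ht2 hs1 p.2.1 else pxFlip ht2 hs1 p.2.1, by
      rw [MulAction.mem_stabilizer_iff]
      split_ifs
      · change pxReverse ht2 hs1 (pxFlip ht2 hs1 p.2.1 (0, 0)) = _
        rw [hflip, hrev]
      · exact hflip p.2⟩
  have hflipinj : ∀ h h' : ZMod t → ZMod 2, pxFlip ht2 hs1 h = pxFlip ht2 hs1 h' → h = h' := by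
    intro h h' heq
    funext j
    have := congrArg (fun φ : praegerXu t s ≃g praegerXu t s => (φ (j, 0)).2 ⟨0, hs1⟩) heq
    simpa [pxFlip_apply] using this
  have hne : ∀ h h' : {h : ZMod t → ZMod 2 // ∀ k : Fin s, h ((k : ℕ) : ZMod t) = 0},
      pxReverse ht2 hs1 * pxFlip ht2 hs1 h.1 ≠ pxFlip ht2 hs1 h'.1 := by
    intro h h' heq
    have h1 : pxArc (pxFlip ht2 hs1 h'.1 (0, 0)) (pxFlip ht2 hs1 h'.1 a₁) :=
      (pxArc_flip _ _ _).2 harc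
    have h2 : pxArc (pxFlip ht2 hs1 h.1 (0, 0)) (pxFlip ht2 hs1 h.1 a₁) :=
      (pxArc_flip _ _ _).2 harc
    have h3 := pxArc_reverse h2
    rw [← pxReverse_apply ht2 hs1, ← pxReverse_apply ht2 hs1, ← RelIso.mul_apply,
      ← RelIso.mul_apply, heq] at h3
    exact praegerXu_not_arc_symm (by omega) h1 h3
  have hF : Function.Bijective F := by
    constructor
    · rintro ⟨b, h⟩ ⟨b', h'⟩ heq
      have heq' := congrArg Subtype.val heq
      cases b <;> cases b' <;> simp only [F, if_true, Bool.false_eq_true, if_false] at heq'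
      · rw [Subtype.ext (hflipinj _ _ heq')]
      · exact absurd heq'.symm (hne _ _)
      · exact absurd heq' (hne _ _)
      · rw [Subtype.ext (hflipinj _ _ (mul_left_cancel heq'))]
    · have pres : ∀ φ : praegerXu t s ≃g praegerXu t s, φ (0, 0) = (0, 0) →
          pxArc (0, 0) (φ a₁) →
          ∃ h : {h : ZMod t → ZMod 2 // ∀ k : Fin s, h ((k : ℕ) : ZMod t) = 0},
            φ = pxFlip ht2 hs1 h.1 := by
        intro φ h0 h1
        have hφ := praegerXu_eq_pxFlip ht2 hs1 φ (fun a b hab =>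
          praegerXu_preserves_arcs ht hs φ harc (by rwa [h0]) hab) (by rw [h0])
        refine ⟨⟨_, fun k => ?_⟩, hφ⟩
        have := congrFun (congrArg Prod.snd h0) k
        rw [hφ, pxFlip_apply] at this
        simpa using this
      rintro ⟨φ, hφ⟩
      have h0 : φ (0, 0) = (0, 0) := hφ
      have hadj : (praegerXu t s).Adj (φ (0, 0)) (φ a₁) :=
        φ.map_adj_iff.2 ((praegerXu_adj_iff ht2 hs1 _ _).2 (.inl harc))
      rw [h0] at hadj
      rcases (praegerXu_adj_iff ht2 hs1 _ _).1 hadj with h1 | h1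
      · obtain ⟨h, hh⟩ := pres φ h0 h1
        exact ⟨(false, h), Subtype.ext hh.symm⟩
      · have hinv : pxReverse (t := t) ht2 hs1 * pxReverse ht2 hs1 = 1 := by
          refine RelIso.ext fun a => ?_
          rw [RelIso.mul_apply, pxReverse_apply, pxReverse_apply]
          simp
        obtain ⟨h, hh⟩ := pres (pxReverse ht2 hs1 * φ) (by rw [RelIso.mul_apply, h0, hrev]) (by
          have h2 := pxArc_reverse h1
          rwa [← pxReverse_apply ht2 hs1, ← pxReverse_apply ht2 hs1, hrev] at h2)
        refine ⟨(true, h), Subtype.ext ?_⟩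
        change pxReverse ht2 hs1 * pxFlip ht2 hs1 h.1 = φ
        rw [← hh, ← mul_assoc, hinv, one_mul]
  rw [← Nat.card_congr (Equiv.ofBijective F hF), Nat.card_prod,
    card_words_vanishing_on_window hst]
  simp [pow_succ, mul_comm]

theorem card_stabilizer_eq_of_map {V : Type*} {G : SimpleGraph V} (φ : G ≃g G) {v w : V}
    (h : φ v = w) : Nat.card (MulAction.stabilizer (G ≃g G) w) =
      Nat.card (MulAction.stabilizer (G ≃g G) v) :=
  (Nat.card_congr (MulAction.stabilizerEquivStabilizer (g := φ) (a := v) h.symm).toEquiv).symm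

theorem praegerXu_card_stabilizer {t s : ℕ} (ht : 5 ≤ t) (hs : 2 ≤ s) (hst : s ≤ t)
    (v : ZMod t × (Fin s → ZMod 2)) :
    Nat.card (MulAction.stabilizer (praegerXu t s ≃g praegerXu t s) v) = 2 ^ (t - s + 1) := by
  obtain ⟨φ, hφ⟩ := praegerXu_exists_map_zero (by omega) (by omega) hst v
  rw [card_stabilizer_eq_of_map φ hφ, praegerXu_card_stabilizer_zero ht hs hst]

theorem isKArc_two_iff {V : Type*} {G : SimpleGraph V} {w : Fin 3 → V} :
    IsKArc G 2 w ↔ G.Adj (w 0) (w 1) ∧ G.Adj (w 1) (w 2) ∧ w 0 ≠ w 2 := by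
  unfold IsKArc
  constructor
  · rintro ⟨h, h'⟩
    exact ⟨h 0, h 1, h' 0 2 rfl⟩
  · rintro ⟨h0, h1, h2⟩
    refine ⟨fun i => ?_, fun i j hij => ?_⟩
    · fin_cases i
      · exact h0
      · exact h1
    · obtain ⟨rfl, rfl⟩ : i = 0 ∧ j = 2 := ⟨Fin.ext (by simp; omega), Fin.ext (by simp; omega)⟩
      exact h2

/-- A directed `2`-arc lies in no `4`-cycle, while the `2`-arc through both in-neighbours of a
vertex does. -/
theorem praegerXu_not_isKArcTransitive {t s : ℕ} (ht : 5 ≤ t) (hs : 2 ≤ s) :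
    ¬ IsKArcTransitive (praegerXu t s) 2 := by
  intro htrans
  have adj := praegerXu_adj_iff (t := t) (s := s) (by omega) (by omega)
  let v : ZMod t × (Fin s → ZMod 2) := (0, 0)
  let a : ZMod 2 → ZMod t × (Fin s → ZMod 2) := fun x => (0 - 1, pxPrev 0 x)
  let b : ZMod t × (Fin s → ZMod 2) := (0 + 1, pxNext 0 0)
  have ha : ∀ x, pxArc (a x) v := pxArc_prev 0 0
  have hb : pxArc v b := pxArc_next 0 0 0
  have hab : a 0 ≠ b := fun h => praegerXu_not_arc_symm (by omega) (ha 0) (h ▸ hb)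
  have haa : a 0 ≠ a 1 := by
    intro h
    have := congrFun (congrArg Prod.snd h) ⟨0, by omega⟩
    simp [a, pxPrev] at this
  obtain ⟨φ, hφ⟩ := htrans ![a 0, v, a 1] ![a 0, v, b]
    (isKArc_two_iff.2 ⟨(adj _ _).2 (.inl (ha 0)), (adj _ _).2 (.inr (ha 1)), haa⟩)
    (isKArc_two_iff.2 ⟨(adj _ _).2 (.inl (ha 0)), (adj _ _).2 (.inl hb), hab⟩)
  have h0 : φ (a 0) = a 0 := hφ 0
  have h1 : φ v = v := hφ 1
  have h2 : φ (a 1) = b := hφ 2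
  have h := praegerXu_same_direction_iff ht hs φ ((adj v (a 0)).2 (.inr (ha 0)))
    ((adj v (a 1)).2 (.inr (ha 1)))
  rw [h0, h1, h2] at h
  have hn := fun x => praegerXu_not_arc_symm (by omega) (ha x)
  exact hn 0 ((h.2 (iff_of_false (hn 0) (hn 1))).2 hb)

/-! ### The cube -/

theorem cubeGraph_adj_iff {d : ℕ} (v w : Fin d → ZMod 2) :
    (cubeGraph d).Adj v w ↔ ∃ i, w = v + Pi.single i 1 := by
  have hbit : ∀ x y : ZMod 2, x ≠ y → y = x + 1 := by decide
  change hammingDist v w = 1 ↔ _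
  rw [hammingDist, Finset.card_eq_one]
  refine exists_congr fun i => ?_
  simp only [Finset.ext_iff, Finset.mem_filter, Finset.mem_univ, true_and, Finset.mem_singleton]
  constructor
  · intro h
    funext j
    by_cases hj : j = i
    · subst hj
      simpa using hbit _ _ ((h j).2 rfl)
    · simpa [hj] using (not_not.1 (mt (h j).1 hj)).symm
  · rintro rfl j
    by_cases hj : j = i
    · subst hj
      simp
    · simp [hj]

theorem cube_add_add_cancel {d : ℕ} (v w : Fin d → ZMod 2) : v + w + w = v := by
  funext i
  simp [add_assoc, CharTwo.add_self_eq_zero]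

/-- The translation by `c` of the cube. -/
def cubeTranslate {d : ℕ} (c : Fin d → ZMod 2) : cubeGraph d ≃g cubeGraph d where
  toEquiv := Equiv.addRight c
  map_rel_iff' := by
    intro v w
    rw [cubeGraph_adj_iff, cubeGraph_adj_iff]
    refine exists_congr fun i => ?_
    simp only [Equiv.coe_addRight]
    rw [add_right_comm, add_left_inj]

/-- The automorphism of the cube that permutes the coordinates. -/
def cubePermute {d : ℕ} (σ : Equiv.Perm (Fin d)) : cubeGraph d ≃g cubeGraph d where
  toEquiv := σ.arrowCongr (Equiv.refl _)
  map_rel_iff' := by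
    intro v w
    rw [cubeGraph_adj_iff, cubeGraph_adj_iff, ← σ.exists_congr_right]
    refine exists_congr fun i => ?_
    rw [← (σ.arrowCongr (Equiv.refl (ZMod 2))).injective.eq_iff (a := w)]
    refine Eq.congr_right (funext fun j => ?_)
    simp [Pi.single_apply, Equiv.symm_apply_eq]

theorem cubePermute_apply {d : ℕ} (σ : Equiv.Perm (Fin d)) (v : Fin d → ZMod 2) :
    cubePermute σ v = v ∘ σ.symm := rfl

theorem cubePermute_single {d : ℕ} (σ : Equiv.Perm (Fin d)) (i : Fin d) :
    cubePermute σ (Pi.single i 1) = Pi.single (σ i) 1 := by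
  funext j
  simp [cubePermute_apply, Pi.single_apply, Equiv.symm_apply_eq]

/-- Two vertices of the cube at distance two have just two common neighbours. -/
theorem cubeGraph_common_neighbor {d : ℕ} {x y : Fin d → ZMod 2} {i j : Fin d} (hij : i ≠ j)
    (hi : (cubeGraph d).Adj (x + Pi.single i 1) y) (hj : (cubeGraph d).Adj (x + Pi.single j 1) y) :
    y = x ∨ y = x + Pi.single i 1 + Pi.single j 1 := by
  obtain ⟨k, rfl⟩ := (cubeGraph_adj_iff _ _).1 hi
  obtain ⟨l, hl⟩ := (cubeGraph_adj_iff _ _).1 hj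
  rw [add_assoc, add_assoc, add_right_inj] at hl
  by_cases hki : k = i
  · left
    rw [hki, cube_add_add_cancel]
  · right
    have := congrFun hl k
    by_cases hkj : k = j
    · rw [hkj]
    · -- The coordinate `k` must be `l`, so that the coordinate `i` of `hl` fails.
      by_cases hkl : k = l
      · subst hkl
        have := congrFun hl i
        simp [hij, Ne.symm hki] at this
      · simp [hki, hkj, hkl] at this

/-- An automorphism of the cube that fixes `0` and all its neighbours is trivial: by induction on
the weight, a word `v` with ones in the places `i ≠ j` is fixed, as the only common neighbour of
`v + e_i` and `v + e_j` besides `v + e_i + e_j`. -/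
theorem cubeGraph_eq_of_fix {d : ℕ} (φ : cubeGraph d ≃g cubeGraph d) (h0 : φ 0 = 0)
    (h1 : ∀ i, φ (Pi.single i 1) = Pi.single i 1) (v : Fin d → ZMod 2) : φ v = v := by
  have hbit : ∀ x : ZMod 2, x ≠ 0 → x = 1 := by decide
  induction hn : hammingNorm v using Nat.strong_induction_on generalizing v with
  | _ n ih =>
    have lower : ∀ (w : Fin d → ZMod 2) (i : Fin d), w i ≠ 0 →
        hammingNorm (w + Pi.single i 1) < hammingNorm w := by
      intro w i hi
      refine Finset.card_lt_card ⟨fun j hj => ?_, fun hsub => ?_⟩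
      · by_cases hji : j = i
        · subst hji
          simpa using hi
        · simpa [hji] using hj
      · have := hsub (Finset.mem_filter.2 ⟨Finset.mem_univ i, hi⟩)
        simp [hbit _ hi, CharTwo.add_self_eq_zero] at this
    have adj : ∀ (w : Fin d → ZMod 2) (i : Fin d), (cubeGraph d).Adj (w + Pi.single i 1) w :=
      fun w i => (cubeGraph_adj_iff _ _).2 ⟨i, (cube_add_add_cancel _ _).symm⟩
    by_cases hv : v = 0
    · rw [hv, h0]
    obtain ⟨i, hi⟩ := Function.ne_iff.1 hv
    by_cases hvi : v = Pi.single i 1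
    · rw [hvi, h1]
    obtain ⟨j, hj⟩ := Function.ne_iff.1 hvi
    have hij : i ≠ j := by
      rintro rfl
      exact hj (by simpa using hbit _ hi)
    have hj' : v j ≠ 0 := by simpa [hij.symm] using hj
    have fixi : φ (v + Pi.single i 1) = v + Pi.single i 1 := ih _ (hn ▸ lower v i hi) _ rfl
    have fixj : φ (v + Pi.single j 1) = v + Pi.single j 1 := ih _ (hn ▸ lower v j hj') _ rfl
    have fixij : φ (v + Pi.single i 1 + Pi.single j 1) = v + Pi.single i 1 + Pi.single j 1 := by
      refine ih _ ?_ _ rfl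
      rw [← hn]
      exact (lower _ j (by simpa [hij.symm] using hj')).trans (lower v i hi)
    rcases cubeGraph_common_neighbor hij (fixi ▸ φ.map_adj_iff.2 (adj v i))
      (fixj ▸ φ.map_adj_iff.2 (adj v j)) with h | h
    · exact h
    · rw [← fixij] at h
      exfalso
      have := congrFun (φ.injective h) i
      simp [hij] at this

/-- The stabilizer of `0` in the cube consists of the permutations of the coordinates. -/
theorem cubeGraph_card_stabilizer_zero (d : ℕ) :
    Nat.card (MulAction.stabilizer (cubeGraph d ≃g cubeGraph d) (0 : Fin d → ZMod 2)) =
      d.factorial := by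
  have hsingle : Function.Injective fun i : Fin d => (Pi.single i 1 : Fin d → ZMod 2) := by
    intro i j h
    by_contra hij
    have := congrFun h i
    simp [hij] at this
  let F : Equiv.Perm (Fin d) →
      MulAction.stabilizer (cubeGraph d ≃g cubeGraph d) (0 : Fin d → ZMod 2) :=
    fun σ => ⟨cubePermute σ, rfl⟩
  have hF : Function.Bijective F := by
    constructor
    · intro σ τ h
      refine Equiv.ext fun i => hsingle ?_
      simp only [← cubePermute_single]
      rw [show cubePermute σ = cubePermute τ from congrArg Subtype.val h]
    · rintro ⟨φ, hφ⟩
      have h0 : φ 0 = 0 := hφ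
      have hex : ∀ i, ∃ j, φ (Pi.single i 1) = Pi.single j 1 := by
        intro i
        have hadj : (cubeGraph d).Adj (φ 0) (φ (Pi.single i 1)) :=
          φ.map_adj_iff.2 ((cubeGraph_adj_iff _ _).2 ⟨i, (zero_add _).symm⟩)
        rw [h0, cubeGraph_adj_iff] at hadj
        simpa using hadj
      choose f hf using hex
      have hfinj : Function.Injective f := by
        intro i j hij
        refine hsingle (φ.injective ?_)
        rw [hf, hf, hij]
      let σ : Equiv.Perm (Fin d) := Equiv.ofBijective f (Finite.injective_iff_bijective.1 hfinj)
      refine ⟨σ, Subtype.ext (RelIso.ext fun v => ?_)⟩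
      have hfix := cubeGraph_eq_of_fix (φ.trans (cubePermute σ).symm)
        ((cubePermute σ).symm_apply_eq.2 h0)
        (fun i => (cubePermute σ).symm_apply_eq.2 ((hf i).trans (cubePermute_single σ i).symm)) v
      exact ((cubePermute σ).symm_apply_eq.1 hfix).symm
  rw [← Nat.card_congr (Equiv.ofBijective F hF), Nat.card_perm, Nat.card_fin]

theorem cubeGraph_card_stabilizer {d : ℕ} (v : Fin d → ZMod 2) :
    Nat.card (MulAction.stabilizer (cubeGraph d ≃g cubeGraph d) v) = d.factorial := by
  rw [card_stabilizer_eq_of_map (cubeTranslate v) (zero_add v), cubeGraph_card_stabilizer_zero]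

theorem exists_perm_map_pair {α : Type*} [DecidableEq α] {a b a' b' : α} (h : a ≠ b)
    (h' : a' ≠ b') : ∃ σ : Equiv.Perm α, σ a = a' ∧ σ b = b' := by
  refine ⟨(Equiv.swap a a').trans (Equiv.swap (Equiv.swap a a' b) b'), ?_, ?_⟩
  · have h1 : a' ≠ Equiv.swap a a' b :=
      fun e => h ((Equiv.swap a a').injective ((Equiv.swap_apply_left a a').trans e))
    rw [Equiv.trans_apply, Equiv.swap_apply_left, Equiv.swap_apply_of_ne_of_ne h1 h']
  · simp

theorem cubeGraph_isKArcTransitive_two (d : ℕ) : IsKArcTransitive (cubeGraph d) 2 := by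
  have ends : ∀ w : Fin 3 → Fin d → ZMod 2, IsKArc (cubeGraph d) 2 w →
      ∃ i j, i ≠ j ∧ w 0 = w 1 + Pi.single i 1 ∧ w 2 = w 1 + Pi.single j 1 := by
    intro w hw
    obtain ⟨h0, h1, h2⟩ := isKArc_two_iff.1 hw
    obtain ⟨i, hi⟩ := (cubeGraph_adj_iff _ _).1 h0.symm
    obtain ⟨j, hj⟩ := (cubeGraph_adj_iff _ _).1 h1
    refine ⟨i, j, ?_, hi, hj⟩
    rintro rfl
    exact h2 (hi.trans hj.symm)
  intro w w' hw hw'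
  obtain ⟨i, j, hij, h0, h2⟩ := ends w hw
  obtain ⟨i', j', hij', h0', h2'⟩ := ends w' hw'
  obtain ⟨σ, hσi, hσj⟩ := exists_perm_map_pair hij hij'
  have h : ∀ x, ((cubeTranslate (w 1)).trans (cubePermute σ)).trans (cubeTranslate (w' 1))
      (w 1 + x) = w' 1 + cubePermute σ x := by
    intro x
    change cubePermute σ (w 1 + x + w 1) + w' 1 = _
    rw [add_comm (w 1) x, cube_add_add_cancel, add_comm]
  refine ⟨((cubeTranslate (w 1)).trans (cubePermute σ)).trans (cubeTranslate (w' 1)), fun k => ?_⟩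
  fin_cases k
  · change _ = w' 0
    rw [show w ((fun i => i) ⟨0, by omega⟩) = _ from h0, h, h0', cubePermute_single, hσi]
  · have := h 0
    rw [add_zero] at this
    exact this.trans (add_zero _)
  · change _ = w' 2
    rw [show w ((fun i => i) ⟨2, by omega⟩) = _ from h2, h, h2', cubePermute_single, hσj]

/-- The isomorphism from `PX(4, 2)` to the `4`-cube. The vertex `(i, (a, b))` stands for the vertex
`⟨i; (p + 2x, q + 2y)⟩` of `CPM(2, 2, 4; 1)`, where `(x, y)` is `(a, b)` or `(b, a)` according to the
parity of `i`, and the parities `(p, q)` are `(0, 0), (1, 0), (1, 1), (0, 1)` for `i = 0, 1, 2, 3`.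
As these determine `i`, the graph is the product of two cycles `ZMod 4`, and each of these is
a `2`-cube through the Gray code `p + 2x ↦ (x, x + p)`. -/
def praegerXuFourTwoToCube (a : ZMod 4 × (Fin 2 → ZMod 2)) : Fin 4 → ZMod 2 :=
  if a.1 = 0 then ![a.2 0, a.2 0, a.2 1, a.2 1]
  else if a.1 = 1 then ![a.2 1, a.2 1 + 1, a.2 0, a.2 0]
  else if a.1 = 2 then ![a.2 0, a.2 0 + 1, a.2 1, a.2 1 + 1]
  else ![a.2 1, a.2 1, a.2 0, a.2 0 + 1]

instance {t s : ℕ} : DecidableRel (pxArc (t := t) (s := s)) := fun a b =>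
  decidable_of_iff (b.1 = a.1 + 1 ∧ ∀ k : Fin s, ∀ h : (k : ℕ) + 1 < s, b.2 k = a.2 ⟨k + 1, h⟩)
    (and_congr_right fun _ => ⟨fun h k hk => h ⟨k, by omega⟩ hk, fun h k hk => h k hk⟩)

set_option maxRecDepth 100000 in
theorem praegerXuFourTwoToCube_injective : Function.Injective praegerXuFourTwoToCube := by
  decide

set_option maxRecDepth 100000 in
theorem praegerXuFourTwoToCube_adj : ∀ a b : ZMod 4 × (Fin 2 → ZMod 2),
    hammingDist (praegerXuFourTwoToCube a) (praegerXuFourTwoToCube b) = 1 ↔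
      (pxArc a b ∨ pxArc b a) := by
  decide

theorem nonempty_praegerXu_four_two_iso_cube : Nonempty (praegerXu 4 2 ≃g cubeGraph 4) :=
  ⟨{ toEquiv := Equiv.ofBijective praegerXuFourTwoToCube
      ((Fintype.bijective_iff_injective_and_card _).2
        ⟨praegerXuFourTwoToCube_injective, by simp⟩)
     map_rel_iff' := by
      intro a b
      rw [praegerXu_adj_iff (by norm_num) (by norm_num)]
      exact praegerXuFourTwoToCube_adj a b }⟩

/-! ### The graph `CPM(m, s, 4; 1)` -/

/-- The index `i mod s` of the coordinate that changes between the layers `i` and `i + 1`. -/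
def cpmIndex (m s : ℕ) [NeZero s] (i : ZMod (m * s)) : Fin s :=
  ⟨i.val % s, Nat.mod_lt _ (Nat.pos_of_neZero s)⟩

theorem cpmIndex_add_one {m s : ℕ} [NeZero m] [NeZero s] (h2 : 2 ≤ m * s) (i : ZMod (m * s)) :
    cpmIndex m s (i + 1) = cpmIndex m s i + 1 := by
  have : Fact (1 < m * s) := ⟨h2⟩
  ext
  rw [Fin.val_add, Fin.val_one']
  simp only [cpmIndex]
  rw [ZMod.val_add, ZMod.val_one, Nat.mod_mul_left_mod, Nat.add_mod_mod, Nat.mod_add_mod]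

/-- The parity of the coordinate `j` at the vertices of `CPM(m, s, 4; 1)` in layer `i`. For
`i = q * s + l` with `l < s` the coordinate has changed `q + 1` times if `j < l`, and `q` times
otherwise. -/
def cpmParity (m s : ℕ) (i : ZMod (m * s)) (j : Fin s) : ZMod 2 :=
  ((i.val + (s - 1 - j)) / s : ℕ)

theorem cpmParity_zero (m s : ℕ) (j : Fin s) : cpmParity m s 0 j = 0 := by
  have : (s - 1 - j) / s = 0 := Nat.div_eq_of_lt (by omega)
  simp [cpmParity, this]

/-- At the step from the last layer to the layer `0` this uses that `m` is even. -/
theorem cpmParity_add_one {m s : ℕ} [NeZero m] [NeZero s] (hm : Even m) (i : ZMod (m * s))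
    (j : Fin s) :
    cpmParity m s (i + 1) j = cpmParity m s i j + if j = cpmIndex m s i then 1 else 0 := by
  have hs : 0 < s := Nat.pos_of_neZero s
  have hj := j.2
  have hstep : (((i.val + 1 + (s - 1 - j)) / s : ℕ) : ZMod 2) =
      cpmParity m s i j + if j = cpmIndex m s i then 1 else 0 := by
    rw [add_right_comm, Nat.succ_div, Nat.cast_add, cpmParity]
    congr 1
    have hdvd : s ∣ i.val + (s - 1 - j) + 1 ↔ j = cpmIndex m s i := by
      rw [show i.val + (s - 1 - j) + 1 = i.val + (s - j) by omega, Fin.ext_iff,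
        ← Nat.modEq_zero_iff_dvd, cpmIndex]
      have h1 : i.val + (s - j) ≡ 0 [MOD s] ↔ i.val ≡ j [MOD s] := by
        rw [← Nat.ModEq.add_iff_right (Nat.ModEq.refl (j : ℕ)) (n := s)]
        rw [show i.val + (s - j) + j = i.val + s by omega, zero_add]
        simp [Nat.ModEq]
      rw [h1, Nat.ModEq, Nat.mod_eq_of_lt hj, eq_comm]
    simp only [hdvd]
    split_ifs <;> simp
  rw [← hstep]
  by_cases hi : i.val + 1 < m * s
  · have : Fact (1 < m * s) := ⟨by omega⟩
    rw [cpmParity, ZMod.val_add, ZMod.val_one, Nat.mod_eq_of_lt hi]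
  · have hlast : i.val + 1 = m * s := by have := ZMod.val_lt i; omega
    have hi0 : i + 1 = 0 := by
      rw [← ZMod.natCast_zmod_val i, ← Nat.cast_one, ← Nat.cast_add, hlast, ZMod.natCast_self]
    have hdiv : (i.val + 1 + (s - 1 - j)) / s = m := by
      rw [hlast, add_comm, Nat.add_mul_div_right _ _ hs, Nat.div_eq_of_lt (by omega), zero_add]
    rw [hi0, cpmParity_zero, hdiv, (ZMod.natCast_eq_zero_iff_even).2 hm]

/-- The low bit of an element of `ZMod 4`. -/
def lowBit (x : ZMod 4) : ZMod 2 := (x.val : ZMod 2)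

/-- The high bit of an element of `ZMod 4`. -/
def highBit (x : ZMod 4) : ZMod 2 := ((x.val / 2 : ℕ) : ZMod 2)

/-- The element of `ZMod 4` with low bit `p` and high bit `u`. -/
def ofBits (p u : ZMod 2) : ZMod 4 := ((p.val + 2 * u.val : ℕ) : ZMod 4)

theorem lowBit_ofBits : ∀ p u, lowBit (ofBits p u) = p := by decide

theorem highBit_ofBits : ∀ p u, highBit (ofBits p u) = u := by decide

theorem eq_of_bits_eq : ∀ x y, lowBit x = lowBit y → highBit x = highBit y → x = y := by decide

/-- A step by `± 1` in `ZMod 4` sets the high bit arbitrarily. -/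
theorem eq_add_or_sub_one_iff : ∀ x y : ZMod 4,
    (y = x + 1 ∨ y = x - 1) ↔ lowBit y = lowBit x + 1 := by decide

/-- The pairs `⟨i; v⟩` whose coordinates have the parities `cpmParity m s i`. -/
def cpmEven (m s : ℕ) : Set (ZMod (m * s) × (Fin s → ZMod 4)) :=
  {a | ∀ j, lowBit (a.2 j) = cpmParity m s a.1 j}

theorem cpmArc_iff {m s : ℕ} [NeZero s] (a b : ZMod (m * s) × (Fin s → ZMod 4)) :
    cpmArc m s 4 1 a b ↔ b.1 = a.1 + 1 ∧ (∀ j ≠ cpmIndex m s a.1, b.2 j = a.2 j) ∧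
      lowBit (b.2 (cpmIndex m s a.1)) = lowBit (a.2 (cpmIndex m s a.1)) + 1 := by
  refine and_congr_right fun _ => ?_
  have hidx : ∀ j : Fin s, (j : ℕ) = a.1.val % s ↔ j = cpmIndex m s a.1 :=
    fun j => by rw [Fin.ext_iff, cpmIndex]
  simp only [hidx, Units.val_one, one_pow]
  rw [← eq_add_or_sub_one_iff]
  constructor
  · rintro (h | h)
    · rw [h]
      exact ⟨fun j hj => by simp [hj], .inl (by simp)⟩
    · rw [h]
      exact ⟨fun j hj => by simp [hj], .inr (by simp)⟩
  · rintro ⟨h, h' | h'⟩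
    · refine .inl (funext fun j => ?_)
      by_cases hj : j = cpmIndex m s a.1
      · rw [hj, h', if_pos rfl]
      · rw [h j hj, if_neg hj, add_zero]
    · refine .inr (funext fun j => ?_)
      by_cases hj : j = cpmIndex m s a.1
      · rw [hj, h', if_pos rfl]
      · rw [h j hj, if_neg hj, sub_zero]

theorem cpmArc_mem_iff {m s : ℕ} [NeZero m] [NeZero s] (hm : Even m)
    {a b : ZMod (m * s) × (Fin s → ZMod 4)} (h : cpmArc m s 4 1 a b) :
    a ∈ cpmEven m s ↔ b ∈ cpmEven m s := by
  obtain ⟨h1, h2, h3⟩ := (cpmArc_iff a b).1 h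
  refine forall_congr' fun j => ?_
  rw [h1, cpmParity_add_one hm]
  by_cases hj : j = cpmIndex m s a.1
  · rw [if_pos hj, hj, h3, add_left_inj]
  · rw [if_neg hj, h2 j hj, add_zero]

/-- The vertex of the Praeger–Xu graph with the same layer, whose word consists of the high bits of
the coordinates, read cyclically from the coordinate that changes next. -/
def cpmToPraegerXu {m s : ℕ} [NeZero s] (a : ZMod (m * s) × (Fin s → ZMod 4)) :
    ZMod (m * s) × (Fin s → ZMod 2) :=
  (a.1, fun k => highBit (a.2 (cpmIndex m s a.1 + k)))

theorem cpmToPraegerXu_bijective {m s : ℕ} [NeZero s] :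
    Function.Bijective fun a : cpmEven m s => cpmToPraegerXu a.1 := by
  constructor
  · rintro ⟨⟨i, v⟩, hv⟩ ⟨⟨i', w⟩, hw⟩ h
    obtain rfl : i = i' := congrArg Prod.fst h
    refine Subtype.ext (Prod.ext rfl (funext fun j => ?_))
    refine eq_of_bits_eq _ _ ((hv j).trans (hw j).symm) ?_
    have := congrFun (congrArg Prod.snd h) (j - cpmIndex m s i)
    simpa [cpmToPraegerXu] using this
  · rintro ⟨i, u⟩
    refine ⟨⟨(i, fun j => ofBits (cpmParity m s i j) (u (j - cpmIndex m s i))),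
      fun j => lowBit_ofBits _ _⟩, Prod.ext rfl (funext fun k => ?_)⟩
    simp [cpmToPraegerXu, highBit_ofBits]

theorem pxArc_cpmToPraegerXu_iff {m s : ℕ} [NeZero m] [NeZero s] (hm : Even m) (hs : 2 ≤ s)
    {a b : ZMod (m * s) × (Fin s → ZMod 4)} (ha : a ∈ cpmEven m s) (hb : b ∈ cpmEven m s) :
    pxArc (cpmToPraegerXu a) (cpmToPraegerXu b) ↔ cpmArc m s 4 1 a b := by
  have h2 : 2 ≤ m * s := hs.trans (Nat.le_mul_of_pos_left s (Nat.pos_of_neZero m))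
  rw [cpmArc_iff]
  refine and_congr_right fun h1 => ?_
  change b.1 = a.1 + 1 at h1
  have hlow : ∀ j, lowBit (b.2 j) = lowBit (a.2 j) + if j = cpmIndex m s a.1 then 1 else 0 := by
    intro j
    rw [hb j, ha j, h1, cpmParity_add_one hm]
  rw [and_iff_left (by simp [hlow])]
  have hone : ((1 : Fin s) : ℕ) = 1 := by rw [Fin.val_one', Nat.mod_eq_of_lt (by omega)]
  have hcast : ∀ (k : ℕ) (hk : k + 1 < s),
      cpmIndex m s b.1 + ⟨k, by omega⟩ = cpmIndex m s a.1 + ⟨k + 1, hk⟩ := by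
    intro k hk
    rw [h1, cpmIndex_add_one h2, add_assoc]
    congr 1
    ext
    rw [Fin.val_add, hone]
    change (1 + k) % s = k + 1
    rw [Nat.mod_eq_of_lt (by omega), add_comm]
  constructor
  · intro h j hj
    refine eq_of_bits_eq _ _ (by simp [hlow, hj]) ?_
    -- The coordinate `j` is read at the nonzero place `j - cpmIndex m s a.1` of the first word.
    obtain ⟨n, hn⟩ : ∃ n, ((j - cpmIndex m s a.1 : Fin s) : ℕ) = n + 1 := by
      refine Nat.exists_eq_succ_of_ne_zero fun h0 => hj (sub_eq_zero.1 (Fin.ext ?_))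
      rw [h0, Fin.val_zero]
    have hns : n + 1 < s := hn ▸ (j - cpmIndex m s a.1).2
    have hjn : cpmIndex m s a.1 + ⟨n + 1, hns⟩ = j := by
      rw [← sub_eq_iff_eq_add'.1 (Fin.ext hn : j - cpmIndex m s a.1 = ⟨n + 1, hns⟩)]
    have := h n hns
    simp only [cpmToPraegerXu] at this
    rwa [hcast n hns, hjn] at this
  · intro h k hk
    simp only [cpmToPraegerXu]
    rw [hcast k hk, h]
    intro h0
    have := congrArg Fin.val (add_eq_left.1 h0)
    rw [Fin.val_zero] at this
    exact absurd this (Nat.succ_ne_zero k)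

theorem cpmBar_adj_iff {m s n : ℕ} {r : (ZMod n)ˣ} (h2 : 2 ≤ m * s)
    (a b : ZMod (m * s) × (Fin s → ZMod n)) :
    (cpmBar m s n r).Adj a b ↔ cpmArc m s n r a b ∨ cpmArc m s n r b a := by
  have : Fact (1 < m * s) := ⟨h2⟩
  have hne : ∀ a b, cpmArc m s n r a b → a ≠ b := by
    rintro a b ⟨h, -⟩ rfl
    simp at h
  rw [cpmBar, SimpleGraph.fromRel_adj]
  refine ⟨fun h => h.2, fun h => ⟨?_, h⟩⟩
  rcases h with h | h
  · exact hne _ _ h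
  · exact (hne _ _ h).symm

/-- The parity condition cuts out a graph isomorphic to the connected Praeger–Xu graph, and no edge
leaves it: it is the component of `⟨0; 0⟩`. -/
theorem nonempty_CPM_iso_praegerXu {m s : ℕ} (hm0 : 0 < m) (hm : Even m) (hs : 2 ≤ s) :
    Nonempty (CPM m s 4 1 ≃g praegerXu (m * s) s) := by
  have : NeZero m := ⟨hm0.ne'⟩
  have : NeZero s := ⟨by omega⟩
  have h2 : 2 ≤ m * s := hs.trans (Nat.le_mul_of_pos_left s hm0)
  let e : cpmEven m s ≃ ZMod (m * s) × (Fin s → ZMod 2) :=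
    Equiv.ofBijective _ cpmToPraegerXu_bijective
  have hadj : ∀ a b : cpmEven m s,
      (praegerXu (m * s) s).Adj (e a) (e b) ↔ (cpmBar m s 4 1).Adj a b := by
    intro a b
    rw [praegerXu_adj_iff h2 (by omega), cpmBar_adj_iff h2]
    exact or_congr (pxArc_cpmToPraegerXu_iff hm hs a.2 b.2)
      (pxArc_cpmToPraegerXu_iff hm hs b.2 a.2)
  have hclosed : ∀ a b, (cpmBar m s 4 1).Adj a b → (a ∈ cpmEven m s ↔ b ∈ cpmEven m s) := by
    intro a b h
    rcases (cpmBar_adj_iff h2 a b).1 h with h | h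
    · exact cpmArc_mem_iff hm h
    · exact (cpmArc_mem_iff hm h).symm
  have hzero : ((0, 0) : ZMod (m * s) × (Fin s → ZMod 4)) ∈ cpmEven m s := fun j => by
    rw [cpmParity_zero]
    rfl
  have hmem : ∀ a, a ∈ cpmEven m s ↔
      a ∈ ((cpmBar m s 4 1).connectedComponentMk (0, 0)).supp := by
    intro a
    rw [SimpleGraph.ConnectedComponent.mem_supp_iff, SimpleGraph.ConnectedComponent.eq]
    refine ⟨fun ha => ?_, fun ha => ha.symm.of_forall_adj (fun _ _ h => (hclosed _ _ h).1) hzero⟩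
    let f : praegerXu (m * s) s →g cpmBar m s 4 1 :=
      ⟨fun x => (e.symm x).1, fun {x y} hxy => (hadj _ _).1 (by simpa using hxy)⟩
    have h := ((praegerXu_connected h2 (by omega)).preconnected (e ⟨a, ha⟩) (e ⟨_, hzero⟩)).map f
    simpa [f] using h
  let e' : CPMVertex m s 4 1 ≃ cpmEven m s := (Equiv.subtypeEquivRight hmem).symm
  exact ⟨{ toEquiv := e'.trans e, map_rel_iff' := fun {a b} => hadj (e' a) (e' b) }⟩

/-! ### Transfer along isomorphisms -/

theorem card_stabilizer_eq_of_iso {V W : Type*} {G : SimpleGraph V} {H : SimpleGraph W}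
    (e : G ≃g H) (v : V) : Nat.card (MulAction.stabilizer (G ≃g G) v) =
      Nat.card (MulAction.stabilizer (H ≃g H) (e v)) := by
  let E : (G ≃g G) ≃ (H ≃g H) :=
    { toFun := fun φ => (e.symm.trans φ).trans e
      invFun := fun ψ => (e.trans ψ).trans e.symm
      left_inv := fun φ => RelIso.ext fun x => by simp
      right_inv := fun ψ => RelIso.ext fun x => by simp }
  refine Nat.card_congr (E.subtypeEquiv fun φ => ?_)
  change φ v = v ↔ e (φ (e.symm (e v))) = e v
  rw [RelIso.symm_apply_apply, e.injective.eq_iff]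

theorem IsKArcTransitive.of_iso {V W : Type*} {G : SimpleGraph V} {H : SimpleGraph W}
    (e : G ≃g H) {k : ℕ} (h : IsKArcTransitive G k) : IsKArcTransitive H k := by
  have harc : ∀ w, IsKArc H k w → IsKArc G k (e.symm ∘ w) := fun w hw =>
    ⟨fun i => e.symm.map_adj_iff.2 (hw.1 i), fun i j hij =>
      fun heq => hw.2 i j hij (e.symm.injective heq)⟩
  intro w w' hw hw'
  obtain ⟨φ, hφ⟩ := h _ _ (harc w hw) (harc w' hw')
  refine ⟨(e.symm.trans φ).trans e, fun i => ?_⟩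
  change e (φ ((e.symm ∘ w) i)) = _
  rw [hφ]
  simp

theorem mainTheorem8 (m s : ℕ) (hm : 0 < m) (hme : Even m) (hs : 2 ≤ s) :
    Nonempty (CPM m s 4 1 ≃g praegerXu (m * s) s) ∧
    (m = 2 ∧ s = 2 →
      Nonempty (CPM m s 4 1 ≃g cubeGraph 4) ∧
      IsKArcTransitive (CPM m s 4 1) 2 ∧
      ∀ v : CPMVertex m s 4 1,
        Nat.card (MulAction.stabilizer (CPM m s 4 1 ≃g CPM m s 4 1) v) = 24) ∧
    (¬(m = 2 ∧ s = 2) →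
      ¬ IsKArcTransitive (CPM m s 4 1) 2 ∧
      ∀ v : CPMVertex m s 4 1,
        Nat.card (MulAction.stabilizer (CPM m s 4 1 ≃g CPM m s 4 1) v) =
          2 ^ (s * (m - 1) + 1)) := by
  obtain ⟨e⟩ := nonempty_CPM_iso_praegerXu hm hme hs
  refine ⟨⟨e⟩, ?_, fun hne => ?_⟩
  · rintro ⟨rfl, rfl⟩
    obtain ⟨c⟩ := nonempty_praegerXu_four_two_iso_cube
    let f : CPM 2 2 4 1 ≃g cubeGraph 4 := e.trans c
    refine ⟨⟨f⟩, (cubeGraph_isKArcTransitive_two 4).of_iso f.symm, fun v => ?_⟩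
    rw [card_stabilizer_eq_of_iso f, cubeGraph_card_stabilizer]
    rfl
  · have ht : 5 ≤ m * s := by
      obtain ⟨k, rfl⟩ := hme
      have h : 2 ≤ k ∨ 3 ≤ s := by omega
      rcases h with h | h
      · exact le_trans (by norm_num) (Nat.mul_le_mul (show 4 ≤ k + k by omega) hs)
      · exact le_trans (by norm_num) (Nat.mul_le_mul (show 2 ≤ k + k by omega) h)
    have hst : s ≤ m * s := Nat.le_mul_of_pos_left s hm
    refine ⟨fun h => praegerXu_not_isKArcTransitive ht hs (h.of_iso e), fun v => ?_⟩
    rw [card_stabilizer_eq_of_iso e, praegerXu_card_stabilizer ht hs hst, Nat.mul_sub_one,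
      mul_comm s m]
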